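/- Let $n \ge 1$ and let $\Sigma$ be a finite alphabet with $|\Sigma| \ge 2$. A \emph{Bayes net} $\mathcal{G}$ on variables $X_1,\dots,X_n$ with values in $\Sigma$ consists of a directed acyclic graph (DAG) on $X_1,\dots,X_n$ together with, for every $i$ and every assignment of values to the parents of $X_i$, a probability distribution on $\Sigma$; if $d_i^-$ is the in-degree of $X_i$, its number of parameters is $\sum_{i=1}^n (|\Sigma|-1)\,|\Sigma|^{d_i^-}$. Two distinct nodes $X, Y$ are d-separated given a set $\mathbf{Z}$ of nodes not containing $X$ and $Y$ if there is no simple path between them, in the underlying undirected graph, on which every collider is in $\mathbf{Z}$ or has a descendant in $\mathbf{Z}$, and every interior non-collider is outside $\mathbf{Z}$. A distribution on $\Sigma^n$ is \emph{Markov with respect to} $\mathcal{G}$ if $X$ and $Y$ are conditionally independent given $\mathbf{Z}$ whenever they are d-separated given $\mathbf{Z}$ in the DAG of $\mathcal{G}$. $\mathrm{TV}$ denotes total variation distance and $\log$ the natural logarithm. \textbf{Theorem.} For every $\delta_0 < 1$ there is a constant $C > 0$, depending only on $\delta_0$ (so $C$ is universal if, say, $\delta \le 1/2$), such that the following holds for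 all $n \ge 1$, all finite alphabets $\Sigma$ with $|\Sigma| \ge 2$, all $p \in \mathbb{N}$, all $\varepsilon > 0$, all $0 < \delta \le \delta_0$, and every integer $m \ge 0$ with $$ m \;\ge\; C \cdot \frac{\log\frac1\delta}{\varepsilon^2}\left( p \log\left(\frac{n|\Sigma|}{\varepsilon}\right) + n\,\frac{\log\left(\frac{p}{n(|\Sigma|-1)}\right)}{\log|\Sigma|}\,\log n \right). $$ There is a learner, not depending on the distribution to be learned, that maps any $m$ points of $\Sigma^n$ to a pair $(\mathcal{G}, \mathbb{Q})$ of a Bayes net $\mathcal{G}$ and a distribution $\mathbb{Q}$ on $\Sigma^n$, such that for every distribution $\mathbb{P}$ on $\Sigma^n$ that is Markov with respect to some Bayes net with at most $p$ parameters, if the learner is given $m$ independent samples from $\mathbb{P}$, then with probability at least $1 - \delta$ its output $\mathcal{G}$ has at most $p$ parameters, $\mathbb{Q}$ is Markov with respect to $\mathcal{G}$, and $\mathrm{TV}(\mathbb{P},\mathbb{Q}) \le \varepsilon$. -/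

import Mathlib

open MeasureTheory

/-- A Bayesian network on the variables `V`, each with values in the alphabet `A`: a directed
acyclic graph together with, for every variable `i` and every assignment of values to its parents,
a probability distribution on `A` (the conditional probability table of `i`). -/
structure BayesNet (V A : Type*) [MeasurableSpace A] where
  /-- the underlying directed graph; `graph.Adj u v` is the arc `u → v` -/
  graph : Digraph V
  acyclic : ∀ v, ¬ Relation.TransGen graph.Adj v v
  /-- the conditional probability tables -/
  cpt : (i : V) → ({j : V // graph.Adj j i} → A) → ProbabilityMeasure A

/-- The number of parameters of a Bayes net: the table of a variable `i` has, for each of the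
`|A| ^ (in-degree of i)` assignments to its parents, `|A| - 1` free entries. -/
noncomputable def BayesNet.numParams {V A : Type*} [Fintype V] [Fintype A] [MeasurableSpace A]
    (G : BayesNet V A) : ℕ :=
  ∑ i : V, (Fintype.card A - 1) * Fintype.card A ^ Nat.card {j : V // G.graph.Adj j i}

/-- `x` and `y` are d-connected given `Z` in the directed graph `G`: some simple path between them
in the underlying undirected graph is such that every interior vertex at which the two arcs of the
path collide is in `Z` or has a descendant in `Z`, and every other interior vertex is outside
`Z`. -/
def DConnected {V : Type*} (G : Digraph V) (x y : V) (Z : Set V) : Prop :=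
  ∃ w : G.toSimpleGraphInclusive.Walk x y, w.IsPath ∧
    ∀ k, k + 2 ≤ w.length →
      ((G.Adj (w.getVert k) (w.getVert (k + 1)) ∧
          G.Adj (w.getVert (k + 2)) (w.getVert (k + 1))) →
        ∃ d ∈ Z, Relation.ReflTransGen G.Adj (w.getVert (k + 1)) d) ∧
      (¬ (G.Adj (w.getVert k) (w.getVert (k + 1)) ∧
          G.Adj (w.getVert (k + 2)) (w.getVert (k + 1))) →
        w.getVert (k + 1) ∉ Z)

/-- The variables `x` and `y` are conditionally independent given the variables in `Z` under `P`:
`P(X_x = a, X_y = b, X_Z = z) P(X_Z = z) = P(X_x = a, X_Z = z) P(X_y = b, X_Z = z)`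
for all values `a`, `b`, `z`. -/
def CondIndepVars {V A : Type*} [MeasurableSpace A] (P : ProbabilityMeasure (V → A))
    (x y : V) (Z : Set V) : Prop :=
  ∀ (a b : A) (z : V → A),
    (P : Measure (V → A)).real {ω | ω x = a ∧ ω y = b ∧ ∀ k ∈ Z, ω k = z k} *
        (P : Measure (V → A)).real {ω | ∀ k ∈ Z, ω k = z k} =
      (P : Measure (V → A)).real {ω | ω x = a ∧ ∀ k ∈ Z, ω k = z k} *
        (P : Measure (V → A)).real {ω | ω y = b ∧ ∀ k ∈ Z, ω k = z k}

/-- `P` is Markov with respect to a directed graph: d-separation implies conditional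
independence. -/
def IsMarkovGraph {V A : Type*} [MeasurableSpace A] (P : ProbabilityMeasure (V → A))
    (G : Digraph V) : Prop :=
  ∀ (x y : V) (Z : Set V), x ≠ y → x ∉ Z → y ∉ Z → ¬ DConnected G x y Z → CondIndepVars P x y Z

/-- `P` is Markov with respect to a Bayes net if it is so with respect to its underlying DAG. -/
def IsMarkov {V A : Type*} [MeasurableSpace A] (P : ProbabilityMeasure (V → A))
    (G : BayesNet V A) : Prop :=
  IsMarkovGraph P G.graph

/-- Total variation distance of two probability distributions on a finite set. -/
noncomputable def tvDist {Ω : Type*} [Fintype Ω] [MeasurableSpace Ω]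
    (P Q : ProbabilityMeasure Ω) : ℝ :=
  (1 / 2) * ∑ ω : Ω, |(P : Measure Ω).real {ω} - (Q : Measure Ω).real {ω}|

set_option linter.unusedSectionVars false

section Acyclic

variable {V : Type*} {G : Digraph V}

/-- A vertex is d-separated from its non-descendants by any set of non-descendants that contains
its parents. -/
theorem not_dConnected_of_parents_subset (hG : ∀ v, ¬ Relation.TransGen G.Adj v v) {x y : V}
    {Z : Set V} (hpa : ∀ j, G.Adj j x → j ∈ Z) (hZ : ∀ z ∈ Z, ¬ Relation.TransGen G.Adj x z)
    (hxy : x ≠ y) (hyZ : y ∉ Z) (hy : ¬ Relation.TransGen G.Adj x y) :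
    ¬ DConnected G x y Z := by
  rintro ⟨w, -, h⟩
  have hlen : 0 < w.length := by
    rcases Nat.eq_zero_or_pos w.length with h0 | h0
    · exact absurd (SimpleGraph.Walk.eq_of_length_eq_zero h0) hxy
    · exact h0
  have key : ∀ k, k < w.length → G.Adj (w.getVert k) (w.getVert (k + 1)) ∧
      Relation.TransGen G.Adj x (w.getVert (k + 1)) := by
    intro k
    induction k with
    | zero =>
      intro hk
      have hadj := w.adj_getVert_succ hk
      rcases hadj.2 with h1 | h1
      · exact ⟨h1, .single (by simpa using h1)⟩
      · exfalso
        have hvx : G.Adj (w.getVert 1) x := by simpa using h1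
        have hvZ := hpa _ hvx
        rcases Nat.lt_or_ge 1 w.length with h2 | h2
        · refine (h 0 h2).2 (fun hc => hG x ?_) hvZ
          have hxv : G.Adj x (w.getVert 1) := by simpa using hc.1
          exact (Relation.TransGen.single hxv).tail hvx
        · have h3 : w.length = 1 := by omega
          rw [← h3, w.getVert_length] at hvZ
          exact hyZ hvZ
    | succ k ih =>
      intro hk
      obtain ⟨h1, h2⟩ := ih (by omega)
      have hadj := w.adj_getVert_succ hk
      rcases hadj.2 with h3 | h3
      · exact ⟨h3, h2.tail h3⟩
      · obtain ⟨d, hd, hr⟩ := (h k (by omega)).1 ⟨h1, h3⟩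
        exact absurd (h2.trans_left hr) (hZ d hd)
  have := (key (w.length - 1) (by omega)).2
  rw [Nat.sub_add_cancel hlen, w.getVert_length] at this
  exact hy this

/-- A set of vertices that contains the parents of its members contains their ancestors. -/
theorem mem_of_transGen {S : Finset V} (hS : ∀ j ∈ S, ∀ u, G.Adj u j → u ∈ S) {u v : V}
    (h : Relation.TransGen G.Adj u v) (hv : v ∈ S) : u ∈ S := by
  induction h using Relation.TransGen.head_induction_on with
  | single h => exact hS _ hv _ h
  | head h _ ih => exact hS _ ih _ h

/-- Induction along an acyclic graph: vertices are added after all of their parents. -/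
theorem acyclic_induction [Fintype V] [DecidableEq V] (hG : ∀ v, ¬ Relation.TransGen G.Adj v v)
    (motive : Finset V → Prop) (empty : motive ∅)
    (insert : ∀ S i, i ∉ S → (∀ j, G.Adj j i → j ∈ S) → (∀ j ∈ S, ∀ u, G.Adj u j → u ∈ S) →
      motive S → motive (insert i S)) : motive Finset.univ := by
  suffices H : ∀ m (S : Finset V), S.card = m → (∀ j ∈ S, ∀ u, G.Adj u j → u ∈ S) → motive S from
    H _ _ rfl (by simp)
  intro m
  induction m with
  | zero => intro S hS _; rw [Finset.card_eq_zero.1 hS]; exact empty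
  | succ m ih =>
    intro S hS hanc
    have hne : (S : Set V).Nonempty := by
      rw [Finset.coe_nonempty, ← Finset.card_pos]; omega
    have : IsStrictOrder V (Function.swap (Relation.TransGen G.Adj)) :=
      { irrefl := hG, trans := fun a b c h1 h2 => Relation.TransGen.trans h2 h1 }
    obtain ⟨i, hi, hmax⟩ := (Finite.wellFounded_of_trans_of_irrefl
      (Function.swap (Relation.TransGen G.Adj))).has_min (S : Set V) hne
    have hi' : i ∈ S := hi
    rw [← Finset.insert_erase hi']
    have hne' : ∀ j ∈ S, ¬ G.Adj i j := fun j hj h => hmax j hj (.single h)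
    have hE : ∀ j ∈ S.erase i, ∀ u, G.Adj u j → u ∈ S.erase i := by
      intro j hj u hu
      have hj' := Finset.mem_of_mem_erase hj
      refine Finset.mem_erase.2 ⟨?_, hanc j hj' u hu⟩
      rintro rfl
      exact hne' j hj' hu
    refine insert _ i (by simp) (fun j hj => Finset.mem_erase.2 ⟨?_, hanc i hi' j hj⟩) hE
      (ih _ (by rw [Finset.card_erase_of_mem hi', hS]; rfl) hE)
    rintro rfl
    exact hne' j hi' hj

end Acyclic

section Marginals

variable {V A : Type*} [Fintype V] [DecidableEq V] [Fintype A] [MeasurableSpace A]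

/-- The probability that the variables in `T` take the values prescribed by `ω`. -/
noncomputable def marginal (P : ProbabilityMeasure (V → A)) (T : Finset V) (ω : V → A) : ℝ :=
  (P : Measure (V → A)).real {η | ∀ k ∈ T, η k = ω k}

theorem marginal_nonneg (P : ProbabilityMeasure (V → A)) (T : Finset V) (ω : V → A) :
    0 ≤ marginal P T ω := measureReal_nonneg

theorem marginal_anti (P : ProbabilityMeasure (V → A)) {S T : Finset V} (h : S ⊆ T) (ω : V → A) :
    marginal P T ω ≤ marginal P S ω :=
  measureReal_mono fun _ hη k hk => hη k (h hk)

theorem marginal_congr (P : ProbabilityMeasure (V → A)) {T : Finset V} {ω ω' : V → A}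
    (h : ∀ k ∈ T, ω k = ω' k) : marginal P T ω = marginal P T ω' := by
  unfold marginal
  congr 1
  ext η
  exact forall₂_congr fun k hk => by rw [h k hk]

theorem marginal_empty (P : ProbabilityMeasure (V → A)) (ω : V → A) : marginal P ∅ ω = 1 := by
  simp [marginal]

theorem marginal_univ (P : ProbabilityMeasure (V → A)) (ω : V → A) :
    marginal P Finset.univ ω = (P : Measure (V → A)).real {ω} := by
  unfold marginal
  congr 1
  ext η
  simp [funext_iff]

/-- Summing over the values of a variable removes it from a marginal. -/
theorem sum_marginal_update [MeasurableSingletonClass A] (P : ProbabilityMeasure (V → A))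
    {T : Finset V} {i : V} (hi : i ∉ T) (ω : V → A) :
    ∑ a, marginal P (insert i T) (Function.update ω i a) = marginal P T ω := by
  unfold marginal
  rw [← measureReal_biUnion_finset]
  · congr 1
    ext η
    simp only [Finset.mem_univ, Set.iUnion_true, Set.mem_iUnion, Set.mem_ofPred_eq]
    constructor
    · rintro ⟨a, ha⟩ k hk
      rw [ha k (Finset.mem_insert_of_mem hk), Function.update_of_ne]
      rintro rfl; exact hi hk
    · intro h
      refine ⟨η i, fun k hk => ?_⟩
      by_cases hki : k = i
      · subst hki; simp
      · rw [Function.update_of_ne hki]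
        exact h k (Finset.mem_of_mem_insert_of_ne hk hki)
  · intro a _ b _ hab
    refine Set.disjoint_left.2 fun η h1 h2 => hab ?_
    have h1' := h1 i (Finset.mem_insert_self _ _)
    have h2' := h2 i (Finset.mem_insert_self _ _)
    simpa using h1'.symm.trans h2'
  · exact fun _ _ => Set.Finite.measurableSet (Set.toFinite _)

end Marginals

section Factorization

variable {V A : Type*} [Fintype V] [DecidableEq V] [Fintype A] [MeasurableSpace A]

open Classical in
/-- The parents of a vertex. -/
noncomputable def parents (G : Digraph V) (i : V) : Finset V := {j | G.Adj j i}

theorem mem_parents {G : Digraph V} {i j : V} : j ∈ parents G i ↔ G.Adj j i := by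
  simp [parents]

/-- The conditional probability of the value `ω i` given the values of `ω` at the parents of `i`
(zero where the condition has probability zero). -/
noncomputable def condKernel (P : ProbabilityMeasure (V → A)) (G : Digraph V) (i : V)
    (ω : V → A) : ℝ :=
  marginal P (insert i (parents G i)) ω / marginal P (parents G i) ω

theorem condKernel_nonneg (P : ProbabilityMeasure (V → A)) (G : Digraph V) (i : V)
    (ω : V → A) : 0 ≤ condKernel P G i ω :=
  div_nonneg (marginal_nonneg _ _ _) (marginal_nonneg _ _ _)

theorem condKernel_le_one (P : ProbabilityMeasure (V → A)) (G : Digraph V) (i : V)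
    (ω : V → A) : condKernel P G i ω ≤ 1 :=
  div_le_one_of_le₀ (marginal_anti _ (Finset.subset_insert _ _) _) (marginal_nonneg _ _ _)

theorem condKernel_congr (P : ProbabilityMeasure (V → A)) (G : Digraph V) {i : V} {ω ω' : V → A}
    (hi : ω i = ω' i) (h : ∀ j, G.Adj j i → ω j = ω' j) :
    condKernel P G i ω = condKernel P G i ω' := by
  unfold condKernel
  rw [marginal_congr P (T := parents G i) fun k hk => h k (mem_parents.1 hk),
    marginal_congr P (T := insert i (parents G i)) (ω := ω) (ω' := ω')]
  intro k hk
  rcases Finset.mem_insert.1 hk with rfl | hk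
  · exact hi
  · exact h k (mem_parents.1 hk)

theorem sum_condKernel_update_le_one [MeasurableSingletonClass A] (P : ProbabilityMeasure (V → A))
    {G : Digraph V} {i : V} (hi : ¬ G.Adj i i) (ω : V → A) :
    ∑ a, condKernel P G i (Function.update ω i a) ≤ 1 := by
  have hi' : i ∉ parents G i := fun h => hi (mem_parents.1 h)
  have : ∀ a, condKernel P G i (Function.update ω i a) =
      marginal P (insert i (parents G i)) (Function.update ω i a) / marginal P (parents G i) ω := by
    intro a
    unfold condKernel
    congr 1
    refine marginal_congr P fun k hk => Function.update_of_ne ?_ _ _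
    rintro rfl; exact hi' hk
  simp_rw [this]
  rw [← Finset.sum_div, sum_marginal_update P hi']
  exact div_self_le_one _

/-- If `P` is Markov with respect to an acyclic graph, then a variable is independent of every set
of non-descendants containing its parents, given its parents. -/
theorem IsMarkovGraph.marginal_mul_marginal {P : ProbabilityMeasure (V → A)} {G : Digraph V}
    (hP : IsMarkovGraph P G) (hG : ∀ v, ¬ Relation.TransGen G.Adj v v) (i : V) (ω : V → A)
    (U : Finset V) (hU : ∀ j ∈ U, ¬ Relation.TransGen G.Adj i j) (hiU : i ∉ U) :
    marginal P (insert i (parents G i ∪ U)) ω * marginal P (parents G i) ω =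
      marginal P (insert i (parents G i)) ω * marginal P (parents G i ∪ U) ω := by
  have hipa : ∀ j ∈ parents G i, ¬ Relation.TransGen G.Adj i j := fun j hj h =>
    hG i (h.tail (mem_parents.1 hj))
  induction U using Finset.induction_on with
  | empty => simp
  | insert y U hy ih =>
    have ih := ih (fun j hj => hU j (Finset.mem_insert_of_mem hj))
      fun h => hiU (Finset.mem_insert_of_mem h)
    rw [Finset.union_insert]
    set T := parents G i ∪ U with hT
    by_cases hyT : y ∈ T
    · rw [Finset.insert_eq_of_mem hyT]; exact ih
    have hiy : i ≠ y := by rintro rfl; exact hiU (Finset.mem_insert_self _ _)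
    have hTd : ∀ j ∈ T, ¬ Relation.TransGen G.Adj i j := by
      intro j hj
      rcases Finset.mem_union.1 hj with h | h
      · exact hipa j h
      · exact hU j (Finset.mem_insert_of_mem h)
    have hiT : i ∉ T := by
      intro h
      rcases Finset.mem_union.1 h with h | h
      · exact hG i (.single (mem_parents.1 h))
      · exact hiU (Finset.mem_insert_of_mem h)
    have hci := hP i y (T : Set V) hiy hiT hyT (not_dConnected_of_parents_subset hG
      (fun j hj => Finset.mem_union_left _ (mem_parents.2 hj)) hTd hiy hyT
      (hU y (Finset.mem_insert_self _ _))) (ω i) (ω y) ω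
    have hci' : marginal P (insert i (insert y T)) ω * marginal P T ω =
        marginal P (insert i T) ω * marginal P (insert y T) ω := by
      simpa [marginal, Finset.forall_mem_insert] using hci
    by_cases h0 : marginal P T ω = 0
    · have h1 : marginal P (insert y T) ω = 0 :=
        le_antisymm (h0 ▸ marginal_anti P (Finset.subset_insert _ _) ω) (marginal_nonneg _ _ _)
      have h2 : marginal P (insert i (insert y T)) ω = 0 :=
        le_antisymm (h1 ▸ marginal_anti P (Finset.subset_insert _ _) ω) (marginal_nonneg _ _ _)
      rw [h1, h2]; ring
    · apply mul_right_cancel₀ h0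
      linear_combination (marginal P (parents G i) ω) * hci' + marginal P (insert y T) ω * ih

/-- The factorization of a distribution that is Markov with respect to an acyclic graph. -/
theorem IsMarkovGraph.eq_prod_condKernel {P : ProbabilityMeasure (V → A)} {G : Digraph V}
    (hP : IsMarkovGraph P G) (hG : ∀ v, ¬ Relation.TransGen G.Adj v v) (ω : V → A) :
    (P : Measure (V → A)).real {ω} = ∏ i, condKernel P G i ω := by
  rw [← marginal_univ]
  refine acyclic_induction hG (fun S => marginal P S ω = ∏ i ∈ S, condKernel P G i ω) ?_ ?_
  · simp [marginal_empty]
  · intro S i hi hpa hS ih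
    rw [Finset.prod_insert hi, ← ih]
    have hsub : parents G i ⊆ S := fun j hj => hpa j (mem_parents.1 hj)
    have h := hP.marginal_mul_marginal hG i ω S (fun j hj h => hi (mem_of_transGen hS h hj)) hi
    rw [Finset.union_eq_right.2 hsub] at h
    unfold condKernel
    by_cases h0 : marginal P (parents G i) ω = 0
    · rw [h0, div_zero, zero_mul]
      exact le_antisymm (h0 ▸ marginal_anti P (hsub.trans (Finset.subset_insert _ _)) ω)
        (marginal_nonneg _ _ _)
    · rw [div_mul_eq_mul_div, ← h, mul_div_cancel_right₀ _ h0]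

end Factorization

section Telescoping

variable {V A : Type*} [Fintype V] [DecidableEq V] [Fintype A]

theorem sum_sum_update (i : V) (h : (V → A) → ℝ) :
    ∑ ω, ∑ a, h (Function.update ω i a) = Fintype.card A * ∑ ω, h ω := by
  let e : (V → A) × A → (V → A) × A := fun x => (Function.update x.1 i x.2, x.1 i)
  have he : Function.Involutive e := by
    rintro ⟨ω, a⟩
    simp [e]
  calc ∑ ω, ∑ a, h (Function.update ω i a) = ∑ x : (V → A) × A, h (e x).1 := by
        rw [Fintype.sum_prod_type]
    _ = ∑ x : (V → A) × A, h x.1 := Equiv.sum_comp (he.toPerm e) (fun x => h x.1)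
    _ = Fintype.card A * ∑ ω, h ω := by
        rw [Fintype.sum_prod_type, Finset.mul_sum]
        simp

/-- Products of sub-Markov kernels along an acyclic graph are close in `L¹` if the kernels are. -/
theorem sum_abs_prod_sub_prod_le [Nonempty A] {G : Digraph V}
    (hG : ∀ v, ¬ Relation.TransGen G.Adj v v) {K L : V → (V → A) → ℝ} {η : ℝ} (hη : 0 ≤ η)
    (hK0 : ∀ i ω, 0 ≤ K i ω) (hL0 : ∀ i ω, 0 ≤ L i ω)
    (hKc : ∀ i ω ω', ω i = ω' i → (∀ j, G.Adj j i → ω j = ω' j) → K i ω = K i ω')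
    (hLc : ∀ i ω ω', ω i = ω' i → (∀ j, G.Adj j i → ω j = ω' j) → L i ω = L i ω')
    (hK1 : ∀ i ω, ∑ a, K i (Function.update ω i a) ≤ 1)
    (hL1 : ∀ i ω, ∑ a, L i (Function.update ω i a) ≤ 1)
    (hKL : ∀ i ω, ∑ a, |K i (Function.update ω i a) - L i (Function.update ω i a)| ≤ η) :
    ∑ ω, |∏ i, K i ω - ∏ i, L i ω| ≤ Fintype.card V * η := by
  set k : ℝ := (Fintype.card A : ℝ) with hk
  have hkpos : 0 < k := by rw [hk]; exact_mod_cast Fintype.card_pos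
  set N : ℝ := k ^ Fintype.card V with hN
  have hNpos : 0 < N := by positivity
  have hcong : ∀ M : V → (V → A) → ℝ,
      (∀ i ω ω', ω i = ω' i → (∀ j, G.Adj j i → ω j = ω' j) → M i ω = M i ω') →
      ∀ (S : Finset V) (i : V), i ∉ S → (∀ j ∈ S, ∀ u, G.Adj u j → u ∈ S) → ∀ ω a,
      ∏ j ∈ S, M j (Function.update ω i a) = ∏ j ∈ S, M j ω := by
    intro M hM S i hi hS ω a
    refine Finset.prod_congr rfl fun j hj => hM j _ _ ?_ fun u hu => ?_
    · exact Function.update_of_ne (by rintro rfl; exact hi hj) _ _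
    · exact Function.update_of_ne (by rintro rfl; exact hi (hS j hj _ hu)) _ _
  have key : k ^ (Finset.univ : Finset V).card * ∑ ω, ∏ i, K i ω ≤ N ∧
      k ^ (Finset.univ : Finset V).card * ∑ ω, |∏ i, K i ω - ∏ i, L i ω| ≤
        N * ((Finset.univ : Finset V).card * η) := by
    refine acyclic_induction hG (fun S => k ^ S.card * ∑ ω, ∏ i ∈ S, K i ω ≤ N ∧
      k ^ S.card * ∑ ω, |∏ i ∈ S, K i ω - ∏ i ∈ S, L i ω| ≤ N * (S.card * η)) ?_ ?_
    · simp [hN, hk]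
    · rintro S i hi - hS ⟨ih1, ih2⟩
      have hf0 : ∀ ω, 0 ≤ ∏ j ∈ S, K j ω := fun ω => Finset.prod_nonneg fun j _ => hK0 j ω
      rw [Finset.card_insert_of_notMem hi]
      simp only [Finset.prod_insert hi]
      constructor
      · rw [pow_succ, mul_assoc, hk, ← sum_sum_update i, ← hk]
        refine le_trans ?_ ih1
        gcongr with ω _
        simp_rw [hcong K hKc S i hi hS]
        rw [← Finset.sum_mul]
        exact mul_le_of_le_one_left (hf0 ω) (hK1 i ω)
      · rw [pow_succ, mul_assoc, hk, ← sum_sum_update i, ← hk]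
        have hstep : ∀ ω, ∑ a, |K i (Function.update ω i a) *
              ∏ j ∈ S, K j (Function.update ω i a) - L i (Function.update ω i a) *
              ∏ j ∈ S, L j (Function.update ω i a)| ≤
            η * ∏ j ∈ S, K j ω + |∏ j ∈ S, K j ω - ∏ j ∈ S, L j ω| := by
          intro ω
          simp_rw [hcong K hKc S i hi hS, hcong L hLc S i hi hS]
          set f := ∏ j ∈ S, K j ω
          set g := ∏ j ∈ S, L j ω
          calc _ ≤ ∑ a, (|K i (Function.update ω i a) - L i (Function.update ω i a)| * f +
                L i (Function.update ω i a) * |f - g|) := by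
                refine Finset.sum_le_sum fun a _ => ?_
                rw [show K i (Function.update ω i a) * f - L i (Function.update ω i a) * g =
                  (K i (Function.update ω i a) - L i (Function.update ω i a)) * f +
                  L i (Function.update ω i a) * (f - g) by ring]
                refine (abs_add_le _ _).trans (le_of_eq ?_)
                rw [abs_mul, abs_mul, abs_of_nonneg (hf0 ω), abs_of_nonneg (hL0 _ _)]
            _ = (∑ a, |K i (Function.update ω i a) - L i (Function.update ω i a)|) * f +
                (∑ a, L i (Function.update ω i a)) * |f - g| := by
                rw [Finset.sum_add_distrib, Finset.sum_mul, Finset.sum_mul]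
            _ ≤ _ := add_le_add (mul_le_mul_of_nonneg_right (hKL i ω) (hf0 ω))
                (mul_le_of_le_one_left (abs_nonneg _) (hL1 i ω))
        calc _ ≤ k ^ S.card * ∑ ω, (η * ∏ j ∈ S, K j ω +
              |∏ j ∈ S, K j ω - ∏ j ∈ S, L j ω|) := by
              gcongr with ω _
              exact hstep ω
          _ = η * (k ^ S.card * ∑ ω, ∏ j ∈ S, K j ω) +
              k ^ S.card * ∑ ω, |∏ j ∈ S, K j ω - ∏ j ∈ S, L j ω| := by
              rw [Finset.sum_add_distrib, ← Finset.mul_sum]; ring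
          _ ≤ η * N + N * (S.card * η) := add_le_add (mul_le_mul_of_nonneg_left ih1 hη) ih2
          _ = _ := by push_cast; ring
  rw [Finset.card_univ] at key
  exact le_of_mul_le_mul_left key.2 hNpos

end Telescoping

section Discretization

variable {V A : Type*} [Fintype V] [DecidableEq V] [Fintype A] [MeasurableSpace A]
  [MeasurableSingletonClass A]

theorem tvDist_le_of_condKernel [Nonempty A] {G : Digraph V}
    (hG : ∀ v, ¬ Relation.TransGen G.Adj v v) {P Q : ProbabilityMeasure (V → A)}
    (hP : IsMarkovGraph P G) (hQ : IsMarkovGraph Q G) {τ : ℝ} (hτ : 0 ≤ τ)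
    (h : ∀ i ω, |condKernel P G i ω - condKernel Q G i ω| ≤ τ) :
    tvDist P Q ≤ Fintype.card V * Fintype.card A * τ / 2 := by
  have hl : ∀ i, ¬ G.Adj i i := fun i hi => hG i (.single hi)
  have := sum_abs_prod_sub_prod_le hG (K := condKernel P G) (L := condKernel Q G)
    (η := Fintype.card A * τ) (by positivity) (condKernel_nonneg P G) (condKernel_nonneg Q G)
    (fun i ω ω' => condKernel_congr P G) (fun i ω ω' => condKernel_congr Q G)
    (fun i => sum_condKernel_update_le_one P (hl i))
    (fun i => sum_condKernel_update_le_one Q (hl i))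
    (fun i ω => (Finset.sum_le_card_nsmul _ _ τ fun a _ => h i _).trans (by simp))
  unfold tvDist
  simp_rw [hP.eq_prod_condKernel hG, hQ.eq_prod_condKernel hG]
  linarith

open Classical in
/-- The assignment with given values at the parents of a vertex and a given value elsewhere. -/
noncomputable def extendParents (G : Digraph V) (i : V) (u : {j // G.Adj j i} → A) (a : A) :
    V → A :=
  fun j => if h : G.Adj j i then u ⟨j, h⟩ else a

theorem condKernel_extendParents {G : Digraph V} {i : V} (hi : ¬ G.Adj i i)
    (P : ProbabilityMeasure (V → A)) (ω : V → A) :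
    condKernel P G i (extendParents G i (fun j => ω j) (ω i)) = condKernel P G i ω := by
  refine condKernel_congr P G ?_ fun j hj => ?_
  · simp [extendParents, hi]
  · simp [extendParents, hj]

/-- The index set of the entries of the conditional probability tables. -/
abbrev TableIndex (A : Type*) (G : Digraph V) : Type _ :=
  Σ i : V, ({j // G.Adj j i} → A) × A

/-- The entries of the conditional probability tables, rounded down to multiples of `1 / M`. -/
noncomputable def roundedTable (P : ProbabilityMeasure (V → A)) (G : Digraph V) (M : ℕ) :
    TableIndex A G → Fin (M + 1) :=
  fun x => ⟨min M ⌊M * condKernel P G x.1 (extendParents G x.1 x.2.1 x.2.2)⌋₊,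
    Nat.lt_succ_of_le (min_le_left _ _)⟩

theorem abs_sub_le_of_floor_mul_eq {M : ℕ} (hM : 0 < M) {x y : ℝ} (hx : 0 ≤ x) (hy : 0 ≤ y)
    (h : ⌊M * x⌋₊ = ⌊M * y⌋₊) : |x - y| ≤ 1 / M := by
  have hM' : (0 : ℝ) < M := by exact_mod_cast hM
  have hx1 := Nat.floor_le (mul_nonneg hM'.le hx)
  have hx2 := Nat.lt_floor_add_one ((M : ℝ) * x)
  have hy1 := Nat.floor_le (mul_nonneg hM'.le hy)
  have hy2 := Nat.lt_floor_add_one ((M : ℝ) * y)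
  rw [h] at hx1 hx2
  rw [abs_le, ← neg_div, div_le_iff₀ hM', le_div_iff₀ hM']
  constructor <;> linarith

theorem tvDist_le_of_roundedTable_eq [Nonempty A] {G : Digraph V}
    (hG : ∀ v, ¬ Relation.TransGen G.Adj v v) {P Q : ProbabilityMeasure (V → A)}
    (hP : IsMarkovGraph P G) (hQ : IsMarkovGraph Q G) {M : ℕ} (hM : 0 < M)
    (h : roundedTable P G M = roundedTable Q G M) :
    tvDist P Q ≤ Fintype.card V * Fintype.card A * (1 / M) / 2 := by
  refine tvDist_le_of_condKernel hG hP hQ (by positivity) fun i ω => ?_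
  have hi : ¬ G.Adj i i := fun hi => hG i (.single hi)
  have h1 := congrArg Fin.val (congrFun h ⟨i, fun j => ω j, ω i⟩)
  simp only [roundedTable, condKernel_extendParents hi] at h1
  have hle : ∀ R : ProbabilityMeasure (V → A), ⌊M * condKernel R G i ω⌋₊ ≤ M := fun R =>
    Nat.floor_le_of_le (mul_le_of_le_one_right (by positivity) (condKernel_le_one R G i ω))
  rw [min_eq_right (hle P), min_eq_right (hle Q)] at h1
  exact abs_sub_le_of_floor_mul_eq hM (condKernel_nonneg _ _ _ _) (condKernel_nonneg _ _ _ _) h1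

end Discretization

section Selection

variable {Ω : Type*} [Fintype Ω] [MeasurableSpace Ω] [MeasurableSingletonClass Ω]

theorem measureReal_sum_indicator_ge_le (P : Measure Ω) [IsProbabilityMeasure P] (m : ℕ)
    (S : Set Ω) {η : ℝ} (hη : 0 ≤ η) (c : ℝ) (hc : c = 1 ∨ c = -1) :
    (Measure.pi fun _ : Fin m => P).real
      {s | m * η ≤ ∑ t, c * (S.indicator 1 (s t) - P.real S)} ≤ Real.exp (-2 * m * η ^ 2) := by
  have hS : MeasurableSet S := (Set.toFinite S).measurableSet
  have hm1 : Measurable (S.indicator (1 : Ω → ℝ)) := measurable_one.indicator hS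
  have hsub : ProbabilityTheory.HasSubgaussianMGF
      (fun x => S.indicator (1 : Ω → ℝ) x - P.real S) ((‖(1 : ℝ) - 0‖₊ / 2) ^ 2) P := by
    have h := ProbabilityTheory.hasSubgaussianMGF_of_mem_Icc (μ := P)
      (X := S.indicator (1 : Ω → ℝ)) (a := 0) (b := 1) hm1.aemeasurable
      (Filter.Eventually.of_forall fun x => by
        by_cases hx : x ∈ S <;> simp [hx])
    simpa [integral_indicator_one hS] using h
  have hsub' : ProbabilityTheory.HasSubgaussianMGF
      (fun x => c * (S.indicator (1 : Ω → ℝ) x - P.real S)) ((‖(1 : ℝ) - 0‖₊ / 2) ^ 2) P := by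
    rcases hc with rfl | rfl
    · simpa using hsub
    · simpa [Pi.neg_def] using hsub.neg
  have hind : ProbabilityTheory.iIndepFun (fun (t : Fin m) (s : Fin m → Ω) =>
      c * (S.indicator (1 : Ω → ℝ) (s t) - P.real S)) (Measure.pi fun _ : Fin m => P) :=
    ProbabilityTheory.iIndepFun_pi (X := fun _ x => c * (S.indicator (1 : Ω → ℝ) x - P.real S))
      fun _ => ((hm1.sub_const _).const_mul c).aemeasurable
  have hX : ∀ t : Fin m, ProbabilityTheory.HasSubgaussianMGF
      (fun s : Fin m → Ω => c * (S.indicator (1 : Ω → ℝ) (s t) - P.real S))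
      ((‖(1 : ℝ) - 0‖₊ / 2) ^ 2) (Measure.pi fun _ : Fin m => P) := by
    intro t
    refine ProbabilityTheory.HasSubgaussianMGF.of_map (Y := fun s : Fin m → Ω => s t)
      (X := fun x => c * (S.indicator (1 : Ω → ℝ) x - P.real S))
      (measurable_pi_apply t).aemeasurable ?_
    rw [(measurePreserving_eval (fun _ : Fin m => P) t).map_eq]
    exact hsub'
  refine (ProbabilityTheory.HasSubgaussianMGF.measure_sum_ge_le_of_iIndepFun hind
    (s := Finset.univ) (fun t _ => hX t) (by positivity)).trans (le_of_eq ?_)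
  congr 1
  rcases Nat.eq_zero_or_pos m with rfl | hm
  · simp
  · have : (m : ℝ) ≠ 0 := by positivity
    simp
    field_simp

theorem measureReal_abs_sum_indicator_ge_le (P : Measure Ω) [IsProbabilityMeasure P] (m : ℕ)
    (S : Set Ω) {η : ℝ} (hη : 0 ≤ η) :
    (Measure.pi fun _ : Fin m => P).real
      {s | m * η ≤ |∑ t, S.indicator 1 (s t) - m * P.real S|} ≤
        2 * Real.exp (-2 * m * η ^ 2) := by
  rw [two_mul]
  refine le_trans ?_ (add_le_add (measureReal_sum_indicator_ge_le P m S hη 1 (Or.inl rfl))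
    (measureReal_sum_indicator_ge_le P m S hη (-1) (Or.inr rfl)))
  refine (measureReal_mono ?_).trans (measureReal_union_le _ _)
  intro s hs
  have hs' : m * η ≤ |∑ t, S.indicator (1 : Ω → ℝ) (s t) - m * P.real S| := hs
  rcases le_abs.1 hs' with h | h
  · left
    simpa using h
  · right
    simpa [add_comm, sub_eq_add_neg, Finset.sum_add_distrib] using h

theorem tvDist_comm (P Q : ProbabilityMeasure Ω) : tvDist P Q = tvDist Q P := by
  simp [tvDist, abs_sub_comm]

theorem tvDist_triangle (P Q R : ProbabilityMeasure Ω) :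
    tvDist P R ≤ tvDist P Q + tvDist Q R := by
  unfold tvDist
  rw [← mul_add, ← Finset.sum_add_distrib]
  gcongr
  exact abs_sub_le _ _ _

theorem measureReal_eq_sum_indicator (P : Measure Ω) [IsProbabilityMeasure P] (S : Set Ω) :
    P.real S = ∑ ω, S.indicator (fun ω => P.real {ω}) ω := by
  classical
  have h := sum_measureReal_singleton (μ := P) (Finset.univ.filter (· ∈ S))
  rw [Finset.coe_filter_univ] at h
  simp only [Set.indicator_apply, ← Finset.sum_filter]
  exact h.symm

theorem sum_measureReal_singleton_eq_one (P : Measure Ω) [IsProbabilityMeasure P] :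
    ∑ ω, P.real {ω} = 1 := by
  simp

/-- The total variation distance is attained at the set where one density exceeds the other. -/
theorem tvDist_eq_sub (P Q : ProbabilityMeasure Ω) :
    tvDist P Q =
      (P : Measure Ω).real {ω | (Q : Measure Ω).real {ω} < (P : Measure Ω).real {ω}} -
      (Q : Measure Ω).real {ω | (Q : Measure Ω).real {ω} < (P : Measure Ω).real {ω}} := by
  have hP := sum_measureReal_singleton_eq_one (P : Measure Ω)
  have hQ := sum_measureReal_singleton_eq_one (Q : Measure Ω)
  rw [measureReal_eq_sum_indicator (P : Measure Ω), measureReal_eq_sum_indicator (Q : Measure Ω),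
    ← Finset.sum_sub_distrib]
  have h0 : ∑ ω, ((P : Measure Ω).real {ω} - (Q : Measure Ω).real {ω}) = 0 := by
    rw [Finset.sum_sub_distrib, hP, hQ, sub_self]
  unfold tvDist
  rw [← add_zero (∑ ω, |_|), ← h0, ← Finset.sum_add_distrib, Finset.mul_sum]
  refine Finset.sum_congr rfl fun ω _ => ?_
  rcases lt_or_ge ((Q : Measure Ω).real {ω}) ((P : Measure Ω).real {ω}) with h | h
  · simp only [Set.indicator_apply, Set.mem_ofPred_eq, if_pos h, abs_of_pos (sub_pos.2 h)]
    ring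
  · simp only [Set.indicator_apply, Set.mem_ofPred_eq, if_neg h.not_gt,
      abs_of_nonpos (sub_nonpos.2 h)]
    ring

theorem abs_measureReal_sub_le_tvDist (P Q : ProbabilityMeasure Ω) (S : Set Ω) :
    |(P : Measure Ω).real S - (Q : Measure Ω).real S| ≤ tvDist P Q := by
  have aux : ∀ P Q : ProbabilityMeasure Ω,
      (P : Measure Ω).real S - (Q : Measure Ω).real S ≤ tvDist P Q := by
    intro P Q
    rw [tvDist_eq_sub, measureReal_eq_sum_indicator (P : Measure Ω),
      measureReal_eq_sum_indicator (Q : Measure Ω), measureReal_eq_sum_indicator (P : Measure Ω),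
      measureReal_eq_sum_indicator (Q : Measure Ω), ← Finset.sum_sub_distrib,
      ← Finset.sum_sub_distrib]
    refine Finset.sum_le_sum fun ω _ => ?_
    classical
    simp only [Set.indicator_apply, Set.mem_ofPred_eq]
    split_ifs <;> linarith
  rw [abs_le]
  constructor
  · have := aux Q P
    rw [tvDist_comm] at this
    linarith
  · exact aux P Q

theorem tvDist_le_one (P Q : ProbabilityMeasure Ω) : tvDist P Q ≤ 1 := by
  rw [tvDist_eq_sub]
  have h1 : (P : Measure Ω).real {ω | (Q : Measure Ω).real {ω} < (P : Measure Ω).real {ω}} ≤ 1 :=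
    measureReal_le_one
  have h2 : 0 ≤ (Q : Measure Ω).real {ω | (Q : Measure Ω).real {ω} < (P : Measure Ω).real {ω}} :=
    measureReal_nonneg
  linarith

/-- Minimum distance selection: a class of distributions covered by the finitely many fibres of a
map, each of small diameter, can be learned properly. -/
theorem exists_proper_learner {C I : Type*} [Nonempty C] [Fintype I]
    (q : C → ProbabilityMeasure Ω) (F : C → I) {α η : ℝ}
    (hF : ∀ c c', F c = F c' → tvDist (q c) (q c') ≤ α) (hη : 0 ≤ η) (m : ℕ) :
    ∃ learner : (Fin m → Ω) → C, ∀ c,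
      1 - 2 * (Fintype.card I : ℝ) ^ 2 * Real.exp (-2 * m * η ^ 2) ≤
        (Measure.pi fun _ : Fin m => (q c : Measure Ω)).real
          {s | tvDist (q c) (q (learner s)) ≤ 3 * α + 2 * η} := by
  classical
  set r : I → C := Function.invFun F
  have hr : ∀ c, F (r (F c)) = F c := fun c => Function.invFun_eq ⟨c, rfl⟩
  set Y : I → I → Set Ω := fun j k =>
    {ω | ((q (r k) : Measure Ω)).real {ω} < (q (r j) : Measure Ω).real {ω}} with hY
  set fits : (Fin m → Ω) → I → Prop := fun s i => ∀ j k,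
    |∑ t, (Y j k).indicator (1 : Ω → ℝ) (s t) - m * (q (r i) : Measure Ω).real (Y j k)| ≤
      m * (α + η) with hfits
  refine ⟨fun s => if h : ∃ i, fits s i then r h.choose else Classical.arbitrary C, fun c => ?_⟩
  set bad : I × I → Set (Fin m → Ω) := fun x =>
    {s | m * η ≤ |∑ t, (Y x.1 x.2).indicator (1 : Ω → ℝ) (s t) -
      m * (q c : Measure Ω).real (Y x.1 x.2)|} with hbad
  have hbadle : (Measure.pi fun _ : Fin m => (q c : Measure Ω)).real (⋃ x, bad x) ≤
      2 * (Fintype.card I : ℝ) ^ 2 * Real.exp (-2 * m * η ^ 2) := by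
    refine (measureReal_iUnion_fintype_le _).trans ((Finset.sum_le_sum fun x _ =>
      measureReal_abs_sum_indicator_ge_le (q c : Measure Ω) m (Y x.1 x.2) hη).trans (le_of_eq ?_))
    simp
    ring
  have hmeas : MeasurableSet (⋃ x, bad x) := (Set.toFinite _).measurableSet
  have hcompl := probReal_compl_eq_one_sub
    (μ := (Measure.pi fun _ : Fin m => (q c : Measure Ω))) hmeas
  refine le_trans (by linarith) (hcompl.symm.le.trans (measureReal_mono ?_))
  intro s hs
  have hgood : ∀ j k, |∑ t, (Y j k).indicator (1 : Ω → ℝ) (s t) -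
      m * (q c : Measure Ω).real (Y j k)| < m * η := by
    intro j k
    by_contra hcon
    exact hs (Set.mem_iUnion.2 ⟨(j, k), not_lt.1 hcon⟩)
  have hnear : tvDist (q c) (q (r (F c))) ≤ α := hF _ _ (hr c).symm
  have hm : (0 : ℝ) < m := by
    rcases Nat.eq_zero_or_pos m with h0 | h0
    · have := hgood (F c) (F c)
      subst h0
      simp at this
    · exact_mod_cast h0
  have hfit : fits s (F c) := by
    intro j k
    have h1 := (abs_measureReal_sub_le_tvDist (q c) (q (r (F c))) (Y j k)).trans hnear
    have h2 := (hgood j k).le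
    calc _ = |(∑ t, (Y j k).indicator (1 : Ω → ℝ) (s t) - m * (q c : Measure Ω).real (Y j k)) +
          m * ((q c : Measure Ω).real (Y j k) - (q (r (F c)) : Measure Ω).real (Y j k))| := by
          ring_nf
      _ ≤ m * η + m * α := by
          refine (abs_add_le _ _).trans (add_le_add h2 ?_)
          rw [abs_mul, abs_of_pos hm]
          exact mul_le_mul_of_nonneg_left h1 hm.le
      _ = _ := by ring
  have hex : ∃ i, fits s i := ⟨_, hfit⟩
  show tvDist (q c) (q (if h : ∃ i, fits s i then r h.choose else Classical.arbitrary C)) ≤ _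
  rw [dif_pos hex]
  set i := hex.choose
  have hi : fits s i := hex.choose_spec
  have hij : tvDist (q (r (F c))) (q (r i)) ≤ 2 * (α + η) := by
    rw [tvDist_eq_sub]
    have h1 := abs_le.1 (hi (F c) i)
    have h2 := abs_le.1 (hfit (F c) i)
    refine le_of_mul_le_mul_left ?_ hm
    simp only [hY] at h1 h2
    linarith [h1.1, h1.2, h2.1, h2.2]
  have := tvDist_triangle (q c) (q (r (F c))) (q (r i))
  linarith

end Selection

section Covering

/-- A loopless digraph with at most `E` arcs is encoded by `E` ordered pairs of vertices. -/
theorem exists_arc_code {V : Type*} [Finite V] [Nonempty V] (G : Digraph V)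
    (hG : ∀ v, ¬ G.Adj v v) {E : ℕ} (hE : Nat.card {x : V × V // G.Adj x.1 x.2} ≤ E) :
    ∃ f : Fin E → V × V, ∀ u v, G.Adj u v ↔ u ≠ v ∧ ∃ t, f t = (u, v) := by
  obtain ⟨v₀⟩ := ‹Nonempty V›
  let emb : {x : V × V // G.Adj x.1 x.2} → Fin E := fun x => Fin.castLE hE (Finite.equivFin _ x)
  have hemb : Function.Injective emb :=
    (Fin.castLE_injective hE).comp (Finite.equivFin _).injective
  refine ⟨Function.extend emb Subtype.val fun _ => (v₀, v₀), fun u v => ⟨fun h => ⟨?_, ?_⟩, ?_⟩⟩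
  · rintro rfl; exact hG _ h
  · exact ⟨emb ⟨(u, v), h⟩, hemb.extend_apply _ _ _⟩
  · rintro ⟨huv, t, ht⟩
    by_cases hx : ∃ x, emb x = t
    · obtain ⟨x, rfl⟩ := hx
      rw [hemb.extend_apply] at ht
      have := x.2
      rwa [ht] at this
    · rw [Function.extend_apply' _ _ _ hx] at ht
      obtain ⟨rfl, rfl⟩ := Prod.mk.inj ht
      exact absurd rfl huv

theorem exists_injective_of_card_le {X : Type*} [Finite X] (Y : Type*) [Nonempty Y] {N : ℕ}
    (h : Nat.card X ≤ N) : ∃ f : (X → Y) → Fin N → Y, Function.Injective f := by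
  obtain ⟨y₀⟩ := ‹Nonempty Y›
  let emb : X → Fin N := fun x => Fin.castLE h (Finite.equivFin _ x)
  have hemb : Function.Injective emb :=
    (Fin.castLE_injective h).comp (Finite.equivFin _).injective
  refine ⟨fun g => Function.extend emb g fun _ => y₀, fun g g' hg => funext fun x => ?_⟩
  have := congrFun hg (emb x)
  simpa [hemb.extend_apply] using this

variable {V A : Type*} [Fintype V] [DecidableEq V] [Fintype A] [MeasurableSpace A]

/-- The pairs of a Bayes net with at most `p` parameters and a distribution that is Markov with
respect to it. -/
abbrev MarkovPair (V A : Type*) [Fintype V] [Fintype A] [MeasurableSpace A] (p : ℕ) : Type _ :=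
  {x : BayesNet V A × ProbabilityMeasure (V → A) // x.1.numParams ≤ p ∧ IsMarkov x.2 x.1}

theorem card_tableIndex_le (hA : 2 ≤ Fintype.card A) (H : BayesNet V A) :
    Nat.card (TableIndex A H.graph) ≤ 2 * H.numParams := by
  classical
  rw [Nat.card_sigma, BayesNet.numParams, Finset.mul_sum]
  refine Finset.sum_le_sum fun i _ => ?_
  rw [Nat.card_prod, Nat.card_fun, Nat.card_eq_fintype_card (α := A), mul_comm, ← mul_assoc]
  exact Nat.mul_le_mul_right _ (by omega)

theorem exists_signature [MeasurableSingletonClass A] [Nonempty V] (hA : 2 ≤ Fintype.card A)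
    {p E M : ℕ} (hM : 0 < M) (hE : ∀ H : BayesNet V A, H.numParams ≤ p →
      Nat.card {x : V × V // H.graph.Adj x.1 x.2} ≤ E) :
    ∃ F : MarkovPair V A p → (Fin E → V × V) × (Fin (2 * p) → Fin (M + 1)),
      ∀ c c', F c = F c' → tvDist c.1.2 c'.1.2 ≤
        Fintype.card V * Fintype.card A * (1 / M) / 2 := by
  have : Nonempty A := Fintype.card_pos_iff.1 (by omega)
  have h1 : ∀ G : Digraph V, ∃ f : Fin E → V × V, (∀ v, ¬ G.Adj v v) →
      Nat.card {x : V × V // G.Adj x.1 x.2} ≤ E →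
      ∀ u v, G.Adj u v ↔ u ≠ v ∧ ∃ t, f t = (u, v) := by
    intro G
    by_cases h : (∀ v, ¬ G.Adj v v) ∧ Nat.card {x : V × V // G.Adj x.1 x.2} ≤ E
    · obtain ⟨f, hf⟩ := exists_arc_code G h.1 h.2
      exact ⟨f, fun _ _ => hf⟩
    · exact ⟨fun _ => Classical.arbitrary _, fun ha hb => absurd ⟨ha, hb⟩ h⟩
  have h2 : ∀ G : Digraph V, ∃ f : (TableIndex A G → Fin (M + 1)) → Fin (2 * p) → Fin (M + 1),
      Nat.card (TableIndex A G) ≤ 2 * p → Function.Injective f := by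
    intro G
    by_cases h : Nat.card (TableIndex A G) ≤ 2 * p
    · obtain ⟨f, hf⟩ := exists_injective_of_card_le (Fin (M + 1)) h
      exact ⟨f, fun _ => hf⟩
    · exact ⟨fun _ _ => 0, fun ha => absurd ha h⟩
  choose enc henc using h1
  choose code hcode using h2
  refine ⟨fun c => (enc c.1.1.graph, code c.1.1.graph (roundedTable c.1.2 c.1.1.graph M)), ?_⟩
  rintro ⟨⟨H, P⟩, hp, hP⟩ ⟨⟨H', P'⟩, hp', hP'⟩ hcc
  obtain ⟨hc1, hc2⟩ := Prod.mk.inj hcc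
  dsimp only at hc1 hc2 hp hp' ⊢
  have hloop : ∀ (H : BayesNet V A) (v : V), ¬ H.graph.Adj v v := fun H v hv =>
    H.acyclic v (.single hv)
  have hgraph : H.graph = H'.graph := by
    ext u v
    rw [henc _ (hloop H) (hE H hp), henc _ (hloop H') (hE H' hp'), hc1]
  have hPG : IsMarkovGraph P' H.graph := hgraph ▸ hP'
  rw [← hgraph] at hc2
  exact tvDist_le_of_roundedTable_eq H.acyclic hP hPG hM
    (hcode H.graph ((card_tableIndex_le hA H).trans (by omega)) hc2)

/-- The number of arcs of a Bayes net in terms of its number of parameters, by concavity of the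
logarithm. -/
theorem card_arcs_le [Nonempty V] (hA : 2 ≤ Fintype.card A) {p : ℕ} (H : BayesNet V A)
    (hp : H.numParams ≤ p) :
    (Nat.card {x : V × V // H.graph.Adj x.1 x.2} : ℝ) ≤
      Fintype.card V * (Real.log (p / (Fintype.card V * ((Fintype.card A : ℝ) - 1))) /
        Real.log (Fintype.card A)) := by
  classical
  set d : V → ℕ := fun i => Nat.card {j // H.graph.Adj j i} with hd
  let e : {x : V × V // H.graph.Adj x.1 x.2} ≃ Σ i : V, {j // H.graph.Adj j i} :=
    { toFun := fun x => ⟨x.1.2, x.1.1, x.2⟩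
      invFun := fun x => ⟨(x.2.1, x.1), x.2.2⟩
      left_inv := fun _ => rfl
      right_inv := fun _ => rfl }
  rw [Nat.card_congr e, Nat.card_sigma]
  set k : ℝ := (Fintype.card A : ℝ) with hk
  set N : ℝ := (Fintype.card V : ℝ) with hN
  have hk2 : (2 : ℝ) ≤ k := by rw [hk]; exact_mod_cast hA
  have hNpos : 0 < N := by rw [hN]; exact_mod_cast Fintype.card_pos
  have hsum : (k - 1) * ∑ i, k ^ d i ≤ p := by
    have : ((∑ i : V, (Fintype.card A - 1) * Fintype.card A ^ d i : ℕ) : ℝ) ≤ p := by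
      exact_mod_cast hp
    rw [← Finset.mul_sum] at this
    push_cast [Nat.cast_sub (by omega : 1 ≤ Fintype.card A)] at this
    exact this
  have hS : N ≤ ∑ i, k ^ d i := by
    calc N = ∑ _i : V, (1 : ℝ) := by simp [hN]
      _ ≤ _ := Finset.sum_le_sum fun i _ => one_le_pow₀ (by linarith)
  have hk1 : 0 < k - 1 := by linarith
  have hppos : (0 : ℝ) < p := 
    (mul_pos hk1 (hNpos.trans_le hS)).trans_le hsum
  set μ : ℝ := p / (N * (k - 1)) with hμ
  have hμpos : 0 < μ := by positivity
  have hlogk : 0 < Real.log k := Real.log_pos (by linarith)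
  rw [mul_div_assoc', le_div_iff₀ hlogk]
  have hterm : ∀ i, (d i : ℝ) * Real.log k ≤ Real.log μ + k ^ d i / μ - 1 := by
    intro i
    have hx : 0 < k ^ d i := by positivity
    have := Real.log_le_sub_one_of_pos (div_pos hx hμpos)
    rw [Real.log_div hx.ne' hμpos.ne', Real.log_pow] at this
    linarith
  have hdiv : (∑ i, k ^ d i) / μ ≤ N := by
    rw [div_le_iff₀ hμpos, hμ, mul_div_assoc', mul_div_mul_left _ _ hNpos.ne',
      le_div_iff₀ hk1]
    linarith
  calc ((∑ i, d i : ℕ) : ℝ) * Real.log k = ∑ i, (d i : ℝ) * Real.log k := by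
        push_cast; rw [Finset.sum_mul]
    _ ≤ ∑ i, (Real.log μ + k ^ d i / μ - 1) := Finset.sum_le_sum fun i _ => hterm i
    _ = N * Real.log μ + (∑ i, k ^ d i) / μ - N := by
        rw [Finset.sum_sub_distrib, Finset.sum_add_distrib, ← Finset.sum_div]
        simp [hN]
    _ ≤ N * Real.log μ := by linarith

end Covering

section SampleSize

theorem log_ceil_add_one_le {x : ℝ} (hx : 2 ≤ x) :
    Real.log ((⌈5 / 2 * x⌉₊ : ℝ) + 1) ≤ 3 * Real.log x := by
  have h1 := (Nat.ceil_lt_add_one (show 0 ≤ 5 / 2 * x by linarith)).le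
  calc Real.log ((⌈5 / 2 * x⌉₊ : ℝ) + 1) ≤ Real.log (x ^ 3) := by
        refine Real.log_le_log (by positivity) ?_
        nlinarith [mul_nonneg (sub_nonneg.2 hx) (sub_nonneg.2 hx),
          mul_nonneg (mul_nonneg (sub_nonneg.2 hx) (sub_nonneg.2 hx)) (sub_nonneg.2 hx)]
    _ = 3 * Real.log x := by rw [Real.log_pow]; norm_num

/-- The sample size suffices for a union bound over `N ^ 2` events if `log N` is at most `6 * B`. -/
theorem two_mul_sq_mul_exp_le {N B ε δ δ₁ m : ℝ} (hN : 0 < N) (hB : Real.log 2 ≤ B)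
    (hNB : Real.log N ≤ 6 * B) (hε : 0 < ε) (hδ : 0 < δ) (hδ₁ : δ ≤ δ₁) (hδ₁' : δ₁ < 1)
    (hm : 25 / 2 * (13 / Real.log (1 / δ₁) + 2) * (Real.log (1 / δ) / ε ^ 2 * B) ≤ m) :
    2 * N ^ 2 * Real.exp (-2 * m * (ε / 5) ^ 2) ≤ δ := by
  have hδ₁0 : 0 < δ₁ := hδ.trans_le hδ₁
  set L₁ := Real.log (1 / δ₁) with hL₁
  have hL₁pos : 0 < L₁ := Real.log_pos (by rw [lt_div_iff₀ hδ₁0]; linarith)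
  set L := Real.log (1 / δ) with hL
  have hLL : L₁ ≤ L := Real.log_le_log (by positivity) (by gcongr)
  have hlogδ : Real.log δ = -L := by rw [hL, one_div, Real.log_inv, neg_neg]
  have hlog2 := Real.log_two_gt_d9
  have hmε : 25 / 2 * (13 / L₁ + 2) * (L * B) ≤ m * ε ^ 2 := by
    have := mul_le_mul_of_nonneg_right hm (sq_nonneg ε)
    calc _ = 25 / 2 * (13 / L₁ + 2) * (L / ε ^ 2 * B) * ε ^ 2 := by field_simp
      _ ≤ _ := this
  have h13 : 13 * B ≤ 13 / L₁ * (L * B) := by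
    have : 13 / L₁ * (L * B) = 13 * B * (L / L₁) := by field_simp
    rw [this]
    exact le_mul_of_one_le_right (by linarith) ((one_le_div hL₁pos).2 hLL)
  have h2 : L ≤ 2 * (L * B) := by nlinarith
  rw [← Real.log_le_log_iff (by positivity) hδ, Real.log_mul (by positivity) (by positivity),
    Real.log_mul (by positivity) (by positivity), Real.log_pow, Real.log_exp, hlogδ]
  push_cast
  nlinarith

end SampleSize

theorem BayesNet.nonempty (V A : Type*) [MeasurableSpace A] [Nonempty A] :
    Nonempty (BayesNet V A) :=
  ⟨{ graph := ⟨fun _ _ => False⟩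
     acyclic := fun v h => by
      obtain ⟨b, -, h⟩ := Relation.TransGen.tail'_iff.1 h
      exact h
     cpt := fun _ _ => ⟨Measure.dirac (Classical.arbitrary A), inferInstance⟩ }⟩

/-- Constants: `C` depends only on an upper bound `δ₀ < 1` for the failure probability. The learner
depends on `n`, `A`, `p`, `ε`, `δ` and the number `m` of samples, but not on `P`. -/
theorem theorem2 (δ₀ : ℝ) (hδ₀ : δ₀ < 1) :
    ∃ C : ℝ, 0 < C ∧
      ∀ (n : ℕ) (A : Type*) [Fintype A] [MeasurableSpace A] [MeasurableSingletonClass A]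
        (p : ℕ) (ε δ : ℝ), 1 ≤ n → 2 ≤ Fintype.card A → 0 < ε → 0 < δ → δ ≤ δ₀ →
      ∀ m : ℕ,
        C * (Real.log (1 / δ) / ε ^ 2 *
          (p * Real.log (n * Fintype.card A / ε) +
            n * (Real.log (p / (n * ((Fintype.card A : ℝ) - 1))) /
              Real.log (Fintype.card A)) * Real.log n)) ≤ m →
      ∃ learner : (Fin m → (Fin n → A)) → BayesNet (Fin n) A × ProbabilityMeasure (Fin n → A),
        ∀ P : ProbabilityMeasure (Fin n → A),
          (∃ H : BayesNet (Fin n) A, H.numParams ≤ p ∧ IsMarkov P H) →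
          1 - δ ≤ (Measure.pi fun _ : Fin m => (P : Measure (Fin n → A))).real
            {s | (learner s).1.numParams ≤ p ∧ IsMarkov (learner s).2 (learner s).1 ∧
              tvDist P (learner s).2 ≤ ε} := by
  set δ₁ := max δ₀ (1 / 2) with hδ₁
  have hδ₁' : δ₁ < 1 := max_lt hδ₀ (by norm_num)
  have hδ₁0 : 0 < δ₁ := lt_max_of_lt_right (by norm_num)
  have hL₁ : 0 < Real.log (1 / δ₁) := Real.log_pos (by rw [lt_div_iff₀ hδ₁0]; linarith)
  refine ⟨25 / 2 * (13 / Real.log (1 / δ₁) + 2), by positivity, ?_⟩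
  intro n A _ _ _ p ε δ hn hA hε hδ hδδ₀ m hm
  have hAne : Nonempty A := Fintype.card_pos_iff.1 (by omega)
  have : Nonempty (Fin n) := ⟨⟨0, hn⟩⟩
  rcases isEmpty_or_nonempty (MarkovPair (Fin n) A p) with hempty | hnonempty
  · obtain ⟨H⟩ := BayesNet.nonempty (Fin n) A
    refine ⟨fun _ => (H, ⟨Measure.dirac (Classical.arbitrary _), inferInstance⟩), fun P hP => ?_⟩
    obtain ⟨H', hH'⟩ := hP
    exact hempty.elim ⟨(H', P), hH'⟩
  suffices hlearn : ∃ learner : (Fin m → Fin n → A) → MarkovPair (Fin n) A p,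
      ∀ c : MarkovPair (Fin n) A p,
        1 - δ ≤ (Measure.pi fun _ : Fin m => (c.1.2 : Measure (Fin n → A))).real
          {s | tvDist c.1.2 (learner s).1.2 ≤ ε} by
    obtain ⟨learner, h⟩ := hlearn
    refine ⟨fun s => (learner s).1, ?_⟩
    rintro P ⟨H, hH⟩
    refine (h ⟨(H, P), hH⟩).trans (measureReal_mono fun s hs => ?_)
    exact ⟨(learner s).2.1, (learner s).2.2, hs⟩
  rcases le_or_gt 1 ε with hε1 | hε1
  · refine ⟨fun _ => Classical.arbitrary _, fun c => ?_⟩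
    have : {s : Fin m → Fin n → A | tvDist c.1.2
        (Classical.arbitrary (MarkovPair (Fin n) A p)).1.2 ≤ ε} = Set.univ :=
      Set.eq_univ_of_forall fun s => (tvDist_le_one _ _).trans hε1
    rw [this, probReal_univ]
    linarith
  set k : ℝ := (Fintype.card A : ℝ) with hk
  have hk2 : (2 : ℝ) ≤ k := by rw [hk]; exact_mod_cast hA
  have hn1 : (1 : ℝ) ≤ n := by exact_mod_cast hn
  set x : ℝ := n * k / ε with hx
  have hx2 : 2 ≤ x := by
    rw [hx, le_div_iff₀ hε]
    nlinarith
  set D : ℝ := n * (Real.log (p / (n * (k - 1))) / Real.log k) with hD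
  have harcs : ∀ H : BayesNet (Fin n) A, H.numParams ≤ p →
      (Nat.card {x : Fin n × Fin n // H.graph.Adj x.1 x.2} : ℝ) ≤ D := by
    intro H hp
    simpa using card_arcs_le hA H hp
  obtain ⟨⟨⟨H₀, P₀⟩, hp₀, -⟩⟩ := id hnonempty
  have hD0 : 0 ≤ D := (Nat.cast_nonneg _).trans (harcs H₀ hp₀)
  have hp1 : (1 : ℝ) ≤ p := by
    have : 1 ≤ H₀.numParams := by
      unfold BayesNet.numParams
      refine le_trans ?_ (Finset.single_le_sum (fun i _ => Nat.zero_le _)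
        (Finset.mem_univ (⟨0, hn⟩ : Fin n)))
      exact Nat.one_le_iff_ne_zero.2 (Nat.mul_ne_zero (by omega) (pow_ne_zero _ (by omega)))
    exact_mod_cast this.trans hp₀
  have hM : 0 < ⌈5 / 2 * x⌉₊ := Nat.ceil_pos.2 (by linarith)
  obtain ⟨F, hF⟩ := exists_signature (V := Fin n) hA (p := p) (E := ⌊D⌋₊) hM
    fun H hp => Nat.le_floor (harcs H hp)
  have hα : (Fintype.card (Fin n) : ℝ) * Fintype.card A * (1 / (⌈5 / 2 * x⌉₊ : ℝ)) / 2 ≤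
      ε / 5 := by
    have h1 : 5 / 2 * x ≤ ⌈5 / 2 * x⌉₊ := Nat.le_ceil _
    have h2 : (n : ℝ) * k = x * ε := by rw [hx]; field_simp
    rw [Fintype.card_fin, ← hk, h2, mul_one_div, div_div, div_le_div_iff₀ (by positivity)
      (by norm_num)]
    nlinarith
  obtain ⟨learner, hlearner⟩ := exists_proper_learner
    (fun c : MarkovPair (Fin n) A p => c.1.2) F (α := ε / 5) (η := ε / 5)
    (fun c c' h => (hF c c' h).trans hα) (by positivity) m
  refine ⟨learner, fun c => ?_⟩
  have h := hlearner c
  rw [show 3 * (ε / 5) + 2 * (ε / 5) = ε by ring] at h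
  refine le_trans ?_ h
  refine sub_le_sub_left ?_ 1
  have hlogx : Real.log 2 ≤ Real.log x := Real.log_le_log (by norm_num) hx2
  have hlog2 : 0 < Real.log 2 := Real.log_pos (by norm_num)
  have hlogn : 0 ≤ Real.log n := Real.log_nonneg hn1
  refine two_mul_sq_mul_exp_le (B := p * Real.log x + D * Real.log n) ?_ ?_ ?_ hε hδ
    (hδδ₀.trans (le_max_left _ _)) hδ₁' hm
  · exact_mod_cast Fintype.card_pos
  · nlinarith [mul_nonneg hD0 hlogn]
  · have hE : (⌊D⌋₊ : ℝ) ≤ D := Nat.floor_le hD0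
    have hl := log_ceil_add_one_le hx2
    have hn0 : (n : ℝ) ≠ 0 := by positivity
    have hcard : ((Fintype.card ((Fin ⌊D⌋₊ → Fin n × Fin n) ×
        (Fin (2 * p) → Fin (⌈5 / 2 * x⌉₊ + 1))) : ℕ) : ℝ) =
        ((n : ℝ) * n) ^ ⌊D⌋₊ * ((⌈5 / 2 * x⌉₊ : ℝ) + 1) ^ (2 * p) := by
      simp
    rw [hcard, Real.log_mul (by positivity) (by positivity), Real.log_pow, Real.log_pow,
      Real.log_mul hn0 hn0]
    push_cast
    have h1 := mul_le_mul_of_nonneg_right hE hlogn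
    have h2 := mul_le_mul_of_nonneg_left hl (by positivity : (0 : ℝ) ≤ 2 * p)
    nlinarith [mul_nonneg hD0 hlogn]
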